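/- Let \(k\) be a field and let \(U, H\) be Hopf algebras over \(k\); we use Sweedler notation \(\Delta(h)=h_{(1)}\otimes h_{(2)}\) and write \(S\) for antipodes and \(\epsilon\) for counits. For a Hopf algebra \(K\), a partial representation of \(K\) on a \(k\)-algebra \(B\) is a linear map \(\pi:K\to B\) with \(\pi(1)=1\), \(\pi(x)\pi(y_{(1)})\pi(S(y_{(2)}))=\pi(xy_{(1)})\pi(S(y_{(2)}))\) and \(\pi(x_{(1)})\pi(S(x_{(2)}))\pi(y)=\pi(x_{(1)})\pi(S(x_{(2)})y)\) for all \(x,y\in K\); it is global if it is a morphism of algebras. Let \(K_{par}\) be the quotient of the tensor algebra \(T(K)\) by the relations \(1_K=1\), \(x\otimes y_{(1)}\otimes S(y_{(2)})=xy_{(1)}\otimes S(y_{(2)})\) and \(x_{(1)}\otimes S(x_{(2)})\otimes y=x_{(1)}\otimes S(x_{(2)})y\) for all \(x,y\in K\), and let \([x]\) be the class of \(x \in K\). Let \(A_{par}(K)\) and \(\tilde A_{par}(K)\) be the subalgebras of \(K_{par}\) generated by the elements \(\varepsilon_x=[x_{(1)}][S(x_{(2)})]\), respectively \(\tilde\varepsilon_x=[S(x_{(1)})][x_{(2)}]\),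 for \(x\in K\). Let \(R:H\otimes U\to U\otimes H\), \(R(h\otimes u)=u^R\otimes h^R\), be an invertible linear map such that \(U\#_RH\) is an \(R\)-smash product: \(U\otimes H\) (with \(u\#_R h:=u\otimes h\)) is an associative algebra with unit \(1\#_R1\) for the multiplication \((u\#_Rh)(u'\#_Rh')=u\,u'^R\#_R h^R h'\), and a bialgebra for the tensor product coalgebra structure. Then \(U\#_RH\) is a Hopf algebra with antipode \(S(u\#_Rh)=R(S(h)\otimes S(u))\). Write \(R^{-1}(u\otimes h)=h^{R'}\otimes u^{R'}\) and \(u\blacktriangleright h=\epsilon(u^{R'})h^{R'}\). Suppose that \(U=U_{par}\), i.e. that every partial representation of \(U\) is global. Then there is an isomorphism of algebras \(A_{par}(U\#_RH)\cong A_{par}(H)\) such that \(\varepsilon_{u\#_Rh}\mapsto\varepsilon_{u\blacktriangleright h}\) for all \(u\in U, h\in H\), with inverse given by \(\varepsilon_h\mapsto\varepsilon_{1\#_Rh}\). Likewise, there is an isomorphism of algebras \(\tilde A_{par}(U\#_RH)\cong\tilde A_{par}(H)\) such that \(\tilde\varepsilon_{u\#_Rh}\mapsto\epsilon(u)\tilde\varepsilon_h\)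 for all \(u\in U, h\in H\), with inverse given by \(\tilde\varepsilon_h\mapsto\tilde\varepsilon_{1\#_Rh}\). -/

import Mathlib

open scoped TensorProduct

universe uk uU uH uB

noncomputable section

namespace PartialHopf

open Coalgebra HopfAlgebra

section PartialRepresentations

variable {k : Type uk} [Field k] {H : Type uH} [Ring H] [HopfAlgebra k H]
  {B : Type uB} [Ring B] [Algebra k B]

/-- The linear map `h ↦ f(h₍₁₎) g(h₍₂₎)`, for linear maps `f, g : H → B`. -/
def sweedlerMul (f g : H →ₗ[k] B) : H →ₗ[k] B :=
  LinearMap.mul' k B ∘ₗ TensorProduct.map f g ∘ₗ comul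

/-- A linear map `π : H → B` is a partial representation of `H` on the algebra `B` if, for all
`h, x ∈ H`, `π(1) = 1`, `π(h) π(x₍₁₎) π(S(x₍₂₎)) = π(h x₍₁₎) π(S(x₍₂₎))` and
`π(h₍₁₎) π(S(h₍₂₎)) π(x) = π(h₍₁₎) π(S(h₍₂₎) x)`. -/
structure IsPartialRep (π : H →ₗ[k] B) : Prop where
  map_one : π 1 = 1
  mul_right : ∀ h x : H,
    π h * sweedlerMul π (π ∘ₗ antipode k) x =
      sweedlerMul (π ∘ₗ LinearMap.mulLeft k h) (π ∘ₗ antipode k) x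
  mul_left : ∀ h x : H,
    sweedlerMul π (π ∘ₗ antipode k) h * π x =
      sweedlerMul π (π ∘ₗ LinearMap.mulRight k x ∘ₗ antipode k) h

/-- A linear map is a global representation if it is a morphism of unital algebras. -/
def IsGlobalRep (π : H →ₗ[k] B) : Prop :=
  ∃ f : H →ₐ[k] B, f.toLinearMap = π

variable (k H)

/-- Every partial representation of `H` (on any algebra) is global, that is, `H = H_par`.
The universe of the algebras is the one in which `H_par` itself lives. -/
def EveryPartialRepGlobal : Prop :=
  ∀ (B : Type (max uk uH)) [Ring B] [Algebra k B] (π : H →ₗ[k] B),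
    IsPartialRep π → IsGlobalRep π

/-- The defining relations of `H_par` on the tensor algebra `T(H)`:
`1_H = 1`, `h ⊗ x₍₁₎ ⊗ S(x₍₂₎) = h x₍₁₎ ⊗ S(x₍₂₎)` and
`h₍₁₎ ⊗ S(h₍₂₎) ⊗ x = h₍₁₎ ⊗ S(h₍₂₎) x`. -/
inductive HparRel : TensorAlgebra k H → TensorAlgebra k H → Prop
  | one : HparRel (TensorAlgebra.ι k (1 : H)) 1
  | mul_right (h x : H) : HparRel
      (TensorAlgebra.ι k h *
        sweedlerMul (TensorAlgebra.ι k) (TensorAlgebra.ι k ∘ₗ antipode k) x)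
      (sweedlerMul (TensorAlgebra.ι k ∘ₗ LinearMap.mulLeft k h)
        (TensorAlgebra.ι k ∘ₗ antipode k) x)
  | mul_left (h x : H) : HparRel
      (sweedlerMul (TensorAlgebra.ι k) (TensorAlgebra.ι k ∘ₗ antipode k) h *
        TensorAlgebra.ι k x)
      (sweedlerMul (TensorAlgebra.ι k)
        (TensorAlgebra.ι k ∘ₗ LinearMap.mulRight k x ∘ₗ antipode k) h)

/-- The partial "Hopf" algebra `H_par`, a quotient of the tensor algebra `T(H)`. -/
abbrev Hpar : Type (max uk uH) := RingQuot (HparRel k H)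

/-- The canonical linear map `H → H_par`, `h ↦ [h]`. -/
def bracket : H →ₗ[k] Hpar k H :=
  (RingQuot.mkAlgHom k (HparRel k H)).toLinearMap ∘ₗ TensorAlgebra.ι k

/-- `ε_h = [h₍₁₎][S(h₍₂₎)]`, as an element of `H_par`. -/
def epsHpar : H →ₗ[k] Hpar k H :=
  sweedlerMul (bracket k H) (bracket k H ∘ₗ antipode k)

/-- `ε̃_h = [S(h₍₁₎)][h₍₂₎]`, as an element of `H_par`. -/
def epsTildeHpar : H →ₗ[k] Hpar k H :=
  sweedlerMul (bracket k H ∘ₗ antipode k) (bracket k H)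

/-- `A_par(H)`: the subalgebra of `H_par` generated by the elements `ε_h`. -/
def Apar : Subalgebra k (Hpar k H) := Algebra.adjoin k (Set.range (epsHpar k H))

/-- `Ã_par(H)`: the subalgebra of `H_par` generated by the elements `ε̃_h`. -/
def AparTilde : Subalgebra k (Hpar k H) := Algebra.adjoin k (Set.range (epsTildeHpar k H))

variable {H}

/-- The generator `ε_h` of `A_par(H)`. -/
def eps (h : H) : Apar k H :=
  ⟨epsHpar k H h, Algebra.subset_adjoin ⟨h, rfl⟩⟩

/-- The generator `ε̃_h` of `Ã_par(H)`. -/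
def epsTilde (h : H) : AparTilde k H :=
  ⟨epsTildeHpar k H h, Algebra.subset_adjoin ⟨h, rfl⟩⟩

end PartialRepresentations

section Smash

variable {k : Type uk} [Field k] {U : Type uU} {H : Type uH} [Ring U] [Ring H]

section Algebras

variable [Algebra k U] [Algebra k H]

/-- The bilinear multiplication `(u ⊗ h)(u' ⊗ h') = u u'^R ⊗ h^R h'` on `U ⊗ H`, where
`R(h ⊗ u') = u'^R ⊗ h^R`. -/
def smashMul (R : H ⊗[k] U →ₗ[k] U ⊗[k] H) :
    U ⊗[k] H →ₗ[k] U ⊗[k] H →ₗ[k] U ⊗[k] H :=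
  TensorProduct.lift <| LinearMap.mk₂ k
    (fun u h => TensorProduct.lift <| LinearMap.mk₂ k
      (fun u' h' =>
        TensorProduct.map (LinearMap.mul k U u) ((LinearMap.mul k H).flip h') (R (h ⊗ₜ u')))
      (by intros; simp [TensorProduct.tmul_add])
      (by intros; simp)
      (by intros; simp [TensorProduct.map_add_right])
      (by intros; simp [TensorProduct.map_smul_right]))
    (by intros; ext; simp [TensorProduct.map_add_left])
    (by intros; ext; simp [TensorProduct.map_smul_left])
    (by intros; ext; simp [TensorProduct.add_tmul])
    (by intros; ext; simp [← TensorProduct.smul_tmul'])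

/-- `U #_R H` is a smash product: the multiplication of `U ⊗ H` determined by `R` is associative
with unit `1 ⊗ 1`. -/
class IsSmashProduct (R : H ⊗[k] U →ₗ[k] U ⊗[k] H) : Prop where
  one_mul : ∀ x, smashMul R (1 ⊗ₜ 1) x = x
  mul_one : ∀ x, smashMul R x (1 ⊗ₜ 1) = x
  mul_assoc : ∀ x y z, smashMul R (smashMul R x y) z = smashMul R x (smashMul R y z)

end Algebras

/-- `U #_R H` is an `R`-smash product: it is a smash product, and becomes a bialgebra for the
tensor product coalgebra structure of `U ⊗ H`, that is, counit and comultiplication are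
multiplicative (they always preserve the unit `1 ⊗ 1`). -/
class IsRSmashProduct [Bialgebra k U] [Bialgebra k H] (R : H ⊗[k] U →ₗ[k] U ⊗[k] H) : Prop
    extends IsSmashProduct R where
  counit_mul : ∀ x y : U ⊗[k] H,
    counit (R := k) (smashMul R x y) = counit (R := k) x * counit (R := k) y
  comul_mul : ∀ x y : U ⊗[k] H,
    comul (R := k) (smashMul R x y) =
      TensorProduct.map₂ (smashMul R) (smashMul R) (comul (R := k) x) (comul (R := k) y)

/-- The underlying space `U ⊗ H` of `U #_R H`. -/
def SmashProduct [Algebra k U] [Algebra k H] (_R : H ⊗[k] U →ₗ[k] U ⊗[k] H) :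
    Type (max uU uH) :=
  U ⊗[k] H

namespace SmashProduct

section Ring

variable [Algebra k U] [Algebra k H] (R : H ⊗[k] U →ₗ[k] U ⊗[k] H)

instance : AddCommGroup (SmashProduct R) := inferInstanceAs (AddCommGroup (U ⊗[k] H))

instance : Module k (SmashProduct R) := inferInstanceAs (Module k (U ⊗[k] H))

/-- The element `u #_R h = u ⊗ h`. -/
def mk (u : U) (h : H) : SmashProduct R := (u ⊗ₜ[k] h : U ⊗[k] H)

instance : Mul (SmashProduct R) := ⟨fun x y => smashMul R x y⟩

instance : One (SmashProduct R) := ⟨mk R 1 1⟩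

instance [IsSmashProduct R] : Ring (SmashProduct R) where
  __ := (inferInstance : AddCommGroup (SmashProduct R))
  mul := (· * ·)
  one := 1
  left_distrib x y z := map_add (smashMul R x) y z
  right_distrib x y z := LinearMap.map_add₂ (smashMul R) x y z
  zero_mul x := LinearMap.map_zero₂ (smashMul R) x
  mul_zero x := map_zero (smashMul R x)
  mul_assoc x y z := IsSmashProduct.mul_assoc (R := R) x y z
  one_mul x := IsSmashProduct.one_mul (R := R) x
  mul_one x := IsSmashProduct.mul_one (R := R) x

instance [IsSmashProduct R] : Algebra k (SmashProduct R) :=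
  Algebra.ofModule
    (fun c x y => LinearMap.map_smul₂ (smashMul R) c x y)
    (fun c x y => map_smul (smashMul R x) c y)

variable {R}

theorem mk_mul_mk (u u' : U) (h h' : H) :
    (smashMul R (u ⊗ₜ h) (u' ⊗ₜ h') : U ⊗[k] H) =
      TensorProduct.map (LinearMap.mul k U u) ((LinearMap.mul k H).flip h') (R (h ⊗ₜ u')) := rfl

theorem map_one_one (x : U ⊗[k] H) :
    TensorProduct.map (LinearMap.mul k U 1) ((LinearMap.mul k H).flip 1) x = x := by
  rw [show LinearMap.mul k U 1 = LinearMap.id by ext; simp,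
    show (LinearMap.mul k H).flip 1 = LinearMap.id by ext; simp, TensorProduct.map_id]
  rfl

theorem R_one_tmul [IsSmashProduct R] (u : U) : R (1 ⊗ₜ u) = u ⊗ₜ 1 := by
  have h := IsSmashProduct.one_mul (R := R) (u ⊗ₜ 1)
  rwa [mk_mul_mk, map_one_one] at h

theorem R_tmul_one [IsSmashProduct R] (x : H) : R (x ⊗ₜ 1) = 1 ⊗ₜ x := by
  have h := IsSmashProduct.mul_one (R := R) (1 ⊗ₜ x)
  rwa [mk_mul_mk, map_one_one] at h

variable (R)

/-- The inclusion `U → U #_R H`, `u ↦ u #_R 1`. -/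
def inclU [IsSmashProduct R] : U →ₗ[k] SmashProduct R := (TensorProduct.mk k U H).flip 1

/-- The inclusion `H → U #_R H`, `h ↦ 1 #_R h`. -/
def inclH [IsSmashProduct R] : H →ₗ[k] SmashProduct R := TensorProduct.mk k U H 1

variable [IsSmashProduct R]

theorem inclU_mul (x y : U) : inclU R (x * y) = inclU R x * inclU R y := by
  change ((x * y) ⊗ₜ[k] (1 : H) : U ⊗[k] H) = smashMul R (x ⊗ₜ 1) (y ⊗ₜ 1)
  rw [mk_mul_mk, R_one_tmul]; simp

theorem inclH_mul (x y : H) : inclH R (x * y) = inclH R x * inclH R y := by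
  change ((1 : U) ⊗ₜ[k] (x * y) : U ⊗[k] H) = smashMul R (1 ⊗ₜ x) (1 ⊗ₜ y)
  rw [mk_mul_mk, R_tmul_one]; simp

theorem inclU_mul_inclH (u : U) (h : H) : inclU R u * inclH R h = mk R u h := by
  change (smashMul R (u ⊗ₜ 1) (1 ⊗ₜ h) : U ⊗[k] H) = u ⊗ₜ h
  rw [mk_mul_mk, R_one_tmul]; simp

theorem inclH_mul_inclU (u : U) (h : H) : inclH R h * inclU R u = (R (h ⊗ₜ u) : U ⊗[k] H) := by
  change (smashMul R (1 ⊗ₜ h) (u ⊗ₜ 1) : U ⊗[k] H) = _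
  rw [mk_mul_mk, map_one_one]

end Ring

section Hopf

instance [Bialgebra k U] [Bialgebra k H] (R : H ⊗[k] U →ₗ[k] U ⊗[k] H) :
    Coalgebra k (SmashProduct R) :=
  inferInstanceAs (Coalgebra k (U ⊗[k] H))

instance [Bialgebra k U] [Bialgebra k H] (R : H ⊗[k] U →ₗ[k] U ⊗[k] H) [IsRSmashProduct R] :
    Bialgebra k (SmashProduct R) :=
  Bialgebra.mk' k (SmashProduct R)
    (by
      change counit (R := k) ((1 : U) ⊗ₜ[k] (1 : H)) = 1
      simp)
    (fun {a b} => IsRSmashProduct.counit_mul (R := R) a b)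
    (by
      change comul (R := k) ((1 : U) ⊗ₜ[k] (1 : H)) =
        ((1 : U) ⊗ₜ[k] (1 : H)) ⊗ₜ[k] ((1 : U) ⊗ₜ[k] (1 : H))
      simp [Algebra.TensorProduct.one_def])
    (fun {a b} => by
      refine (IsRSmashProduct.comul_mul (R := R) a b).trans ?_
      change TensorProduct.map₂ (LinearMap.mul k (SmashProduct R)) (LinearMap.mul k (SmashProduct R))
        (comul (R := k) a) (comul (R := k) b) = _
      generalize comul (R := k) a = x
      generalize comul (R := k) b = y
      induction x with
      | zero => simp
      | add x₁ x₂ h₁ h₂ => simp only [map_add, LinearMap.add_apply, add_mul, h₁, h₂]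
      | tmul x₁ x₂ =>
        induction y with
        | zero => simp
        | add y₁ y₂ h₁ h₂ => simp only [map_add, mul_add, h₁, h₂]
        | tmul y₁ y₂ => simp)

variable [HopfAlgebra k U] [HopfAlgebra k H] (R : H ⊗[k] U →ₗ[k] U ⊗[k] H) [IsRSmashProduct R]

/-- The antipode `S(u #_R h) = R(S_H(h) ⊗ S_U(u))` of `U #_R H`. -/
def antipodeMap : SmashProduct R →ₗ[k] SmashProduct R :=
  R ∘ₗ TensorProduct.map (antipode k) (antipode k) ∘ₗ (TensorProduct.comm k U H).toLinearMap

theorem antipodeMap_mk (u : U) (h : H) :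
    antipodeMap R (mk R u h) = inclH R (antipode k h) * inclU R (antipode k u) := by
  rw [inclH_mul_inclU]; rfl

theorem comul_mk {u : U} {h : H} {ι κ : Type*} (𝓡 : Coalgebra.Repr k u ι)
    (𝓢 : Coalgebra.Repr k h κ) :
    comul (R := k) (mk R u h) = ∑ i ∈ 𝓡.index, ∑ j ∈ 𝓢.index,
      mk R (𝓡.left i) (𝓢.left j) ⊗ₜ[k] mk R (𝓡.right i) (𝓢.right j) := by
  change comul (R := k) (u ⊗ₜ[k] h) = _
  rw [TensorProduct.comul_tmul, ← 𝓡.eq, ← 𝓢.eq, TensorProduct.sum_tmul]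
  simp only [TensorProduct.tmul_sum, map_sum]
  rfl

theorem algebraMap_counit_mk (u : U) (h : H) :
    algebraMap k (SmashProduct R) (counit (R := k) (mk R u h)) =
      (counit (R := k) u * counit (R := k) h) • 1 := by
  rw [Algebra.algebraMap_eq_smul_one]
  congr 1
  change counit (R := k) (u ⊗ₜ[k] h) = _
  simp [mul_comm]

theorem antipode_left (u : U) (h : H) :
    LinearMap.mul' k (SmashProduct R)
      ((antipodeMap R).rTensor _ (comul (R := k) (mk R u h))) =
    algebraMap k (SmashProduct R) (counit (R := k) (mk R u h)) := by
  set 𝓡 := Coalgebra.Repr.arbitrary k u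
  set 𝓢 := Coalgebra.Repr.arbitrary k h
  rw [comul_mk R 𝓡 𝓢, algebraMap_counit_mk]
  simp only [map_sum, LinearMap.rTensor_tmul, LinearMap.mul'_apply, antipodeMap_mk]
  rw [Finset.sum_comm]
  have key : ∀ j, ∑ i ∈ 𝓡.index,
      inclH R (antipode k (𝓢.left j)) * inclU R (antipode k (𝓡.left i)) *
        mk R (𝓡.right i) (𝓢.right j) =
      counit (R := k) u • inclH R (antipode k (𝓢.left j) * 𝓢.right j) := by
    intro j
    have : ∀ i, inclH R (antipode k (𝓢.left j)) * inclU R (antipode k (𝓡.left i)) *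
        mk R (𝓡.right i) (𝓢.right j) = inclH R (antipode k (𝓢.left j)) *
          inclU R (antipode k (𝓡.left i) * 𝓡.right i) * inclH R (𝓢.right j) := by
      intro i
      rw [← inclU_mul_inclH, inclU_mul]; simp only [mul_assoc]
    simp only [this]
    rw [← Finset.sum_mul, ← Finset.mul_sum, ← map_sum,
      HopfAlgebra.sum_antipode_mul_eq_smul 𝓡, map_smul,
      show inclU R 1 = 1 from rfl, inclH_mul]
    simp
  simp only [key]
  rw [← Finset.smul_sum, ← map_sum, HopfAlgebra.sum_antipode_mul_eq_smul 𝓢, map_smul,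
    smul_smul]
  rfl

theorem antipode_right (u : U) (h : H) :
    LinearMap.mul' k (SmashProduct R)
      ((antipodeMap R).lTensor _ (comul (R := k) (mk R u h))) =
    algebraMap k (SmashProduct R) (counit (R := k) (mk R u h)) := by
  set 𝓡 := Coalgebra.Repr.arbitrary k u
  set 𝓢 := Coalgebra.Repr.arbitrary k h
  rw [comul_mk R 𝓡 𝓢, algebraMap_counit_mk]
  simp only [map_sum, LinearMap.lTensor_tmul, LinearMap.mul'_apply, antipodeMap_mk]
  have key : ∀ i, ∑ j ∈ 𝓢.index, mk R (𝓡.left i) (𝓢.left j) *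
      (inclH R (antipode k (𝓢.right j)) * inclU R (antipode k (𝓡.right i))) =
      counit (R := k) h • inclU R (𝓡.left i * antipode k (𝓡.right i)) := by
    intro i
    have : ∀ j, mk R (𝓡.left i) (𝓢.left j) *
      (inclH R (antipode k (𝓢.right j)) * inclU R (antipode k (𝓡.right i))) =
        inclU R (𝓡.left i) * inclH R (𝓢.left j * antipode k (𝓢.right j)) *
          inclU R (antipode k (𝓡.right i)) := by
      intro j
      rw [← inclU_mul_inclH, inclH_mul]; simp only [mul_assoc]
    simp only [this]
    rw [← Finset.sum_mul, ← Finset.mul_sum, ← map_sum,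
      HopfAlgebra.sum_mul_antipode_eq_smul 𝓢, map_smul,
      show inclH R 1 = 1 from rfl, inclU_mul]
    simp
  simp only [key]
  rw [← Finset.smul_sum, ← map_sum, HopfAlgebra.sum_mul_antipode_eq_smul 𝓡, map_smul,
    smul_smul, mul_comm]
  rfl

/-- An `R`-smash product of Hopf algebras is a Hopf algebra. -/
instance : HopfAlgebra k (SmashProduct R) where
  antipode := antipodeMap R
  mul_antipode_rTensor_comul :=
    TensorProduct.ext' fun u h => antipode_left R u h
  mul_antipode_lTensor_comul :=
    TensorProduct.ext' fun u h => antipode_right R u h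

end Hopf

end SmashProduct

/-- `u ▶ h = ε(u^{R'}) h^{R'}`, where `R' = R⁻¹` and `R'(u ⊗ h) = h^{R'} ⊗ u^{R'}`. -/
def blackAct [HopfAlgebra k U] [HopfAlgebra k H] (R : H ⊗[k] U ≃ₗ[k] U ⊗[k] H)
    (u : U) (h : H) : H :=
  TensorProduct.rid k H ((counit (R := k) (A := U)).lTensor H (R.symm (u ⊗ₜ h)))

end Smash

end PartialHopf

end

/-! Write K for the smash product, containing U and H. The inclusion of H induces an algebra map
from H_par to K_par (`hparMap`) with ε_h ↦ ε_{1#h} and ε̃_h ↦ ε̃_{1#h}. Both isomorphisms are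
inverses of its restrictions, so two things are needed: the generators coming from U contribute
nothing new, and the map is injective.

For the generators: [·] is multiplicative on U because U = U_par, and the partial representation
axioms upgrade this to [ux] = [u][x] and [xu] = [x][u] for every x in K (`IsPartialRep.isMulAlong`).
In ε_{xu} and ε̃_{ux} the factors from U then meet in the middle and collapse to ε(u). For ε̃ this
applies directly to u#h = uh; for ε, R⁻¹ first rewrites u#h as a sum of products h'u', which
produces u▶h.

For injectivity: a partial representation ρ of H on B is induced to K. As K ≅ H ⊗ U through R, the
induced right module is B ⊗ U, and K acts on it by a partial representation
(`isPartialRep_rightAct`). With ρ the universal one, the image of x in H_par sends 1 ⊗ 1 to x ⊗ 1,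
so x can be recovered. -/

noncomputable section

namespace PartialHopf

open Coalgebra HopfAlgebra

/-! ### Convolution calculus for linear maps out of a Hopf algebra. -/

section Convolution

variable {k : Type uk} [Field k] {K : Type uH} [Ring K] [HopfAlgebra k K]
  {B : Type uB} [Ring B] [Algebra k B]

theorem sweedlerMul_repr {κ : Type*} {x : K} (𝓡 : Coalgebra.Repr k x κ) (f g : K →ₗ[k] B) :
    sweedlerMul f g x = ∑ i ∈ 𝓡.index, f (𝓡.left i) * g (𝓡.right i) := by
  simp [sweedlerMul, ← 𝓡.eq]

theorem sweedlerMul_assoc (f g h : K →ₗ[k] B) :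
    sweedlerMul (sweedlerMul f g) h = sweedlerMul f (sweedlerMul g h) :=
  congrArg WithConv.ofConv (mul_assoc (WithConv.toConv f) (WithConv.toConv g) (WithConv.toConv h))

theorem sweedlerMul_one (f : K →ₗ[k] B) :
    sweedlerMul f (Algebra.linearMap k B ∘ₗ counit) = f :=
  congrArg WithConv.ofConv (mul_one (WithConv.toConv f))

theorem one_sweedlerMul (f : K →ₗ[k] B) :
    sweedlerMul (Algebra.linearMap k B ∘ₗ counit) f = f :=
  congrArg WithConv.ofConv (one_mul (WithConv.toConv f))

theorem comp_sweedlerMul {B' : Type*} [Ring B'] [Algebra k B'] (φ : B →ₐ[k] B')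
    (f g : K →ₗ[k] B) (x : K) :
    φ (sweedlerMul f g x) = sweedlerMul (φ.toLinearMap ∘ₗ f) (φ.toLinearMap ∘ₗ g) x := by
  simp [sweedlerMul_repr (ℛ k x)]

theorem sweedlerMul_antipode_id :
    sweedlerMul (antipode k) (LinearMap.id : K →ₗ[k] K) = Algebra.linearMap k K ∘ₗ counit :=
  congrArg WithConv.ofConv LinearMap.antipode_mul_id

/-- The identity `u₍₁₎ ⊗ S(u₍₂₎) u₍₃₎ = u ⊗ 1`, paired with a bilinear map. -/
theorem sum_left_antipode_mul_right {M : Type*} [AddCommGroup M] [Module k M]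
    (P : K →ₗ[k] K →ₗ[k] M) (u : K) :
    ∑ i ∈ (ℛ k u).index, ∑ j ∈ (ℛ k ((ℛ k u).left i)).index,
      P ((ℛ k ((ℛ k u).left i)).left j)
        (antipode k ((ℛ k ((ℛ k u).left i)).right j) * (ℛ k u).right i) = P u 1 := by
  -- With the two inclusions of K in K ⊗ K, the identity becomes f * (g∘S) * g = f in the
  -- convolution algebra; `TensorProduct.lift P` then transports it to M.
  let f : K →ₗ[k] K ⊗[k] K := (Algebra.TensorProduct.includeLeft (R := k) (S := k)).toLinearMap
  let g : K →ₗ[k] K ⊗[k] K := (Algebra.TensorProduct.includeRight (R := k)).toLinearMap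
  have hg : sweedlerMul (g ∘ₗ antipode k) g = Algebra.linearMap k _ ∘ₗ counit := by
    ext x
    have := comp_sweedlerMul (Algebra.TensorProduct.includeRight (R := k) (A := K) (B := K))
      (antipode k) LinearMap.id x
    rw [sweedlerMul_antipode_id] at this
    refine this.symm.trans ?_
    simp [Algebra.algebraMap_eq_smul_one, Algebra.TensorProduct.one_def]
  have key : sweedlerMul (sweedlerMul f (g ∘ₗ antipode k)) g u = u ⊗ₜ 1 := by
    rw [sweedlerMul_assoc, hg, sweedlerMul_one]; rfl
  have := congrArg (TensorProduct.lift P) key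
  rw [TensorProduct.lift.tmul] at this
  rw [← this, sweedlerMul_repr (ℛ k u), map_sum]
  refine Finset.sum_congr rfl fun i _ => ?_
  rw [sweedlerMul_repr (ℛ k ((ℛ k u).left i)), Finset.sum_mul, map_sum]
  refine Finset.sum_congr rfl fun j _ => ?_
  simp [f, g]

/-- `f((ab)₍₁₎) g((ab)₍₂₎)` in terms of coproducts of `a` and `b`. -/
theorem sweedlerMul_mul {κ κ' : Type*} {a b : K} (𝓡 : Coalgebra.Repr k a κ)
    (𝓢 : Coalgebra.Repr k b κ') (f g : K →ₗ[k] B) :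
    sweedlerMul f g (a * b) = ∑ i ∈ 𝓡.index, ∑ j ∈ 𝓢.index,
      f (𝓡.left i * 𝓢.left j) * g (𝓡.right i * 𝓢.right j) := by
  rw [sweedlerMul, LinearMap.comp_apply, LinearMap.comp_apply, Bialgebra.comul_mul, ← 𝓡.eq,
    ← 𝓢.eq]
  simp [Finset.sum_mul_sum]

end Convolution

/-! ### Pulling back along bialgebra maps. -/

section Restriction

variable {k : Type uk} [Field k] {U : Type uU} [Ring U] [HopfAlgebra k U]
  {K : Type uH} [Ring K] [HopfAlgebra k K] {B : Type uB} [Ring B] [Algebra k B]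
  (ι : U →ₐc[k] K)

theorem sweedlerMul_comp_hom (f g : K →ₗ[k] B) (u : U) :
    sweedlerMul (f ∘ₗ (ι : U →ₗ[k] K)) (g ∘ₗ (ι : U →ₗ[k] K)) u = sweedlerMul f g (ι u) := by
  rw [sweedlerMul_repr (ℛ k u), sweedlerMul_repr ((ℛ k u).induced ι)]
  rfl

variable {ι}

theorem IsPartialRep.comp_hom (hι : ∀ u, antipode k (ι u) = ι (antipode k u)) {π : K →ₗ[k] B}
    (hπ : IsPartialRep π) : IsPartialRep (π ∘ₗ (ι : U →ₗ[k] K)) where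
  map_one := by simpa using hπ.map_one
  mul_right h x := by
    have := hπ.mul_right (ι h) (ι x)
    rw [← sweedlerMul_comp_hom, ← sweedlerMul_comp_hom] at this
    have h₁ : (π ∘ₗ (ι : U →ₗ[k] K)) ∘ₗ antipode k = (π ∘ₗ antipode k) ∘ₗ (ι : U →ₗ[k] K) :=
      LinearMap.ext fun v => by simp [hι]
    have h₂ : (π ∘ₗ (ι : U →ₗ[k] K)) ∘ₗ LinearMap.mulLeft k h =
        (π ∘ₗ LinearMap.mulLeft k (ι h)) ∘ₗ (ι : U →ₗ[k] K) :=
      LinearMap.ext fun v => by simp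
    rw [h₁, h₂]
    exact this
  mul_left h x := by
    have := hπ.mul_left (ι h) (ι x)
    rw [← sweedlerMul_comp_hom, ← sweedlerMul_comp_hom] at this
    have h₁ : (π ∘ₗ (ι : U →ₗ[k] K)) ∘ₗ antipode k = (π ∘ₗ antipode k) ∘ₗ (ι : U →ₗ[k] K) :=
      LinearMap.ext fun v => by simp [hι]
    have h₂ : (π ∘ₗ (ι : U →ₗ[k] K)) ∘ₗ LinearMap.mulRight k x ∘ₗ antipode k =
        (π ∘ₗ LinearMap.mulRight k (ι x) ∘ₗ antipode k) ∘ₗ (ι : U →ₗ[k] K) :=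
      LinearMap.ext fun v => by simp [hι]
    rw [h₁, h₂]
    exact this

/-- The sum is f(x₍₁₎) φ(u₍₁₎) ψ(u₍₂₎) g(x₍₂₎): the factors from U are adjacent, and φ and ψ are
convolution inverse on that side. -/
theorem sweedlerMul_mul_hom_of_counit {f g : K →ₗ[k] B} {φ ψ : U →ₗ[k] B}
    (hf : ∀ x u, f (x * ι u) = f x * φ u) (hg : ∀ x u, g (x * ι u) = ψ u * g x)
    (h : sweedlerMul φ ψ = Algebra.linearMap k B ∘ₗ counit) (x : K) (u : U) :
    sweedlerMul f g (x * ι u) = counit (R := k) u • sweedlerMul f g x := by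
  rw [sweedlerMul_mul (ℛ k x) ((ℛ k u).induced ι), sweedlerMul_repr (ℛ k x), Finset.smul_sum]
  refine Finset.sum_congr rfl fun i _ => ?_
  have := LinearMap.congr_fun h u
  rw [sweedlerMul_repr (ℛ k u)] at this
  calc _ = f ((ℛ k x).left i) * (∑ j ∈ (ℛ k u).index, φ ((ℛ k u).left j) * ψ ((ℛ k u).right j)) *
        g ((ℛ k x).right i) := by
        rw [Finset.mul_sum, Finset.sum_mul]
        refine Finset.sum_congr rfl fun j _ => ?_
        simp only [Coalgebra.Repr.induced, Function.comp, hf, hg, mul_assoc]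
    _ = _ := by rw [this]; simp [Algebra.algebraMap_eq_smul_one]

/-- Here f reverses the order, as π ∘ S does, so the factors from U again end up adjacent in the
middle. -/
theorem sweedlerMul_hom_mul_of_counit {f g : K →ₗ[k] B} {φ ψ : U →ₗ[k] B}
    (hf : ∀ u x, f (ι u * x) = f x * φ u) (hg : ∀ u x, g (ι u * x) = ψ u * g x)
    (h : sweedlerMul φ ψ = Algebra.linearMap k B ∘ₗ counit) (u : U) (x : K) :
    sweedlerMul f g (ι u * x) = counit (R := k) u • sweedlerMul f g x := by
  rw [sweedlerMul_mul ((ℛ k u).induced ι) (ℛ k x), Finset.sum_comm, sweedlerMul_repr (ℛ k x),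
    Finset.smul_sum]
  refine Finset.sum_congr rfl fun i _ => ?_
  have := LinearMap.congr_fun h u
  rw [sweedlerMul_repr (ℛ k u)] at this
  calc _ = f ((ℛ k x).left i) * (∑ j ∈ (ℛ k u).index, φ ((ℛ k u).left j) * ψ ((ℛ k u).right j)) *
        g ((ℛ k x).right i) := by
        rw [Finset.mul_sum, Finset.sum_mul]
        refine Finset.sum_congr rfl fun j _ => ?_
        simp only [Coalgebra.Repr.induced, Function.comp, hf, hg, mul_assoc]
    _ = _ := by rw [this]; simp [Algebra.algebraMap_eq_smul_one]

end Restriction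

/-! ### The universal property of K_par. -/

section Universal

variable {k : Type uk} [Field k] {K : Type uH} [Ring K] [HopfAlgebra k K]

theorem isPartialRep_bracket : IsPartialRep (bracket k K) := by
  have aux (f g : K →ₗ[k] TensorAlgebra k K) (x : K) :=
    comp_sweedlerMul (RingQuot.mkAlgHom k (HparRel k K)) f g x
  refine ⟨?_, fun h x => ?_, fun h x => ?_⟩
  · exact (RingQuot.mkAlgHom_rel k HparRel.one).trans (map_one _)
  · have := RingQuot.mkAlgHom_rel k (HparRel.mul_right (k := k) h x)
    rw [map_mul, aux, aux] at this
    exact this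
  · have := RingQuot.mkAlgHom_rel k (HparRel.mul_left (k := k) h x)
    rw [map_mul, aux, aux] at this
    exact this

variable {B : Type uB} [Ring B] [Algebra k B]

/-- The algebra map `K_par → B` induced by a partial representation. -/
def IsPartialRep.lift {π : K →ₗ[k] B} (hπ : IsPartialRep π) : Hpar k K →ₐ[k] B :=
  RingQuot.liftAlgHom k ⟨TensorAlgebra.lift k π, by
    have hc : (TensorAlgebra.lift k π).toLinearMap ∘ₗ TensorAlgebra.ι k = π := by ext; simp
    rintro _ _ (_ | ⟨h, x⟩ | ⟨h, x⟩)
    · simpa using hπ.map_one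
    · rw [map_mul, comp_sweedlerMul, comp_sweedlerMul]
      simp only [← LinearMap.comp_assoc, hc, TensorAlgebra.lift_ι_apply]
      exact hπ.mul_right h x
    · rw [map_mul, comp_sweedlerMul, comp_sweedlerMul]
      simp only [← LinearMap.comp_assoc, hc, TensorAlgebra.lift_ι_apply]
      exact hπ.mul_left h x⟩

@[simp]
theorem IsPartialRep.lift_bracket {π : K →ₗ[k] B} (hπ : IsPartialRep π) (x : K) :
    hπ.lift (bracket k K x) = π x := by
  simp [IsPartialRep.lift, bracket]

/-- The hypothesis only concerns algebras in the universe of K_par. Applying it to the universal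
partial representation and pushing forward along `lift` frees B from that restriction. -/
theorem IsPartialRep.map_mul_of_everyPartialRepGlobal (hK : EveryPartialRepGlobal k K)
    {π : K →ₗ[k] B} (hπ : IsPartialRep π) (x y : K) : π (x * y) = π x * π y := by
  obtain ⟨f, hf⟩ := hK (Hpar k K) (bracket k K) isPartialRep_bracket
  have h (z) : bracket k K z = f z := (LinearMap.congr_fun hf z).symm
  simp_rw [← hπ.lift_bracket, h, map_mul]

end Universal

/-! ### Maps multiplicative along U, and the defects of the partial representation axioms. -/

section Multiplicative

variable {k : Type uk} [Field k] {U : Type uU} [Ring U] [HopfAlgebra k U]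
  {K : Type uH} [Ring K] [HopfAlgebra k K] {B : Type uB} [Ring B] [Algebra k B]

/-- A unital linear map `π : K → B` is multiplicative along `ι : U → K` if
`π(ι(u)x) = π(ι(u))π(x)` and `π(xι(u)) = π(x)π(ι(u))`. -/
structure IsMulAlong (ι : U →ₐc[k] K) (π : K →ₗ[k] B) : Prop where
  map_one : π 1 = 1
  map_hom_mul : ∀ u x, π (ι u * x) = π (ι u) * π x
  map_mul_hom : ∀ x u, π (x * ι u) = π x * π (ι u)

/-- The failure `π(x)π(y) - π(xy)` of multiplicativity. -/
def mulDefect (π : K →ₗ[k] B) : K →ₗ[k] K →ₗ[k] B :=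
  (LinearMap.mul k B).compl₁₂ π π - (LinearMap.mul k K).compr₂ π

@[simp]
theorem mulDefect_apply (π : K →ₗ[k] B) (x y : K) : mulDefect π x y = π x * π y - π (x * y) := rfl

/-- The failure `π(w)π(x₍₁₎)π(S(x₍₂₎)) - π(wx₍₁₎)π(S(x₍₂₎))` of the first axiom of a partial
representation. -/
def rightDefect (π : K →ₗ[k] B) (w x : K) : B :=
  sweedlerMul (mulDefect π w) (π ∘ₗ antipode k) x

/-- The failure `π(x₍₁₎)π(S(x₍₂₎))π(w) - π(x₍₁₎)π(S(x₍₂₎)w)` of the second axiom of a partial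
representation. -/
def leftDefect (π : K →ₗ[k] B) (x w : K) : B :=
  sweedlerMul π ((mulDefect π).flip w ∘ₗ antipode k) x

theorem rightDefect_eq (π : K →ₗ[k] B) (w x : K) : rightDefect π w x =
    π w * sweedlerMul π (π ∘ₗ antipode k) x -
      sweedlerMul (π ∘ₗ LinearMap.mulLeft k w) (π ∘ₗ antipode k) x := by
  simp [rightDefect, sweedlerMul_repr (ℛ k x), Finset.mul_sum, sub_mul, mul_assoc]

theorem leftDefect_eq (π : K →ₗ[k] B) (x w : K) : leftDefect π x w =
    sweedlerMul π (π ∘ₗ antipode k) x * π w -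
      sweedlerMul π (π ∘ₗ LinearMap.mulRight k w ∘ₗ antipode k) x := by
  simp [leftDefect, sweedlerMul_repr (ℛ k x), Finset.sum_mul, mul_sub, mul_assoc]

theorem isPartialRep_iff (π : K →ₗ[k] B) :
    IsPartialRep π ↔ π 1 = 1 ∧ (∀ w x, rightDefect π w x = 0) ∧ ∀ x w, leftDefect π x w = 0 := by
  simp_rw [rightDefect_eq, leftDefect_eq, sub_eq_zero]
  exact ⟨fun h => ⟨h.1, h.2, h.3⟩, fun h => ⟨h.1, h.2.1, h.2.2⟩⟩

theorem rightDefect_add_left (π : K →ₗ[k] B) (w w' x : K) :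
    rightDefect π (w + w') x = rightDefect π w x + rightDefect π w' x := by
  simp [rightDefect, sweedlerMul_repr (ℛ k x), add_mul, sub_mul, Finset.sum_add_distrib]

theorem rightDefect_smul_left (π : K →ₗ[k] B) (c : k) (w x : K) :
    rightDefect π (c • w) x = c • rightDefect π w x := by
  simp [rightDefect, sweedlerMul_repr (ℛ k x), sub_mul, Finset.smul_sum, smul_sub]

theorem leftDefect_add_right (π : K →ₗ[k] B) (x w w' : K) :
    leftDefect π x (w + w') = leftDefect π x w + leftDefect π x w' := by
  simp [leftDefect, sweedlerMul_repr (ℛ k x), mul_add, mul_sub, Finset.sum_add_distrib]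

theorem leftDefect_smul_right (π : K →ₗ[k] B) (c : k) (x w : K) :
    leftDefect π x (c • w) = c • leftDefect π x w := by
  simp [leftDefect, sweedlerMul_repr (ℛ k x), mul_sub, Finset.smul_sum, smul_sub]

variable {ι : U →ₐc[k] K} {π : K →ₗ[k] B}

namespace IsMulAlong

theorem sweedlerMul_antipode_right (hπ : IsMulAlong ι π) :
    sweedlerMul (π ∘ₗ (ι : U →ₗ[k] K)) (π ∘ₗ (ι : U →ₗ[k] K) ∘ₗ antipode k) =
      Algebra.linearMap k B ∘ₗ counit := by
  refine LinearMap.ext fun u => ?_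
  rw [sweedlerMul_repr (ℛ k u)]
  have := congrArg (fun v => π (ι v)) (HopfAlgebra.sum_mul_antipode_eq_smul (ℛ k u))
  simpa [hπ.map_hom_mul, hπ.map_one, Algebra.algebraMap_eq_smul_one] using this

theorem sweedlerMul_antipode_left (hπ : IsMulAlong ι π) :
    sweedlerMul (π ∘ₗ (ι : U →ₗ[k] K) ∘ₗ antipode k) (π ∘ₗ (ι : U →ₗ[k] K)) =
      Algebra.linearMap k B ∘ₗ counit := by
  refine LinearMap.ext fun u => ?_
  rw [sweedlerMul_repr (ℛ k u)]
  have := congrArg (fun v => π (ι v)) (HopfAlgebra.sum_antipode_mul_eq_smul (ℛ k u))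
  simpa [hπ.map_hom_mul, hπ.map_one, Algebra.algebraMap_eq_smul_one] using this

theorem map_antipode_mul_hom (hπ : IsMulAlong ι π)
    (hι : ∀ u, antipode k (ι u) = ι (antipode k u)) (x : K) (u : U) :
    π (antipode k (x * ι u)) = π (ι (antipode k u)) * π (antipode k x) := by
  rw [antipode_mul_antidistrib, hι, hπ.map_hom_mul]

theorem map_antipode_hom_mul (hπ : IsMulAlong ι π)
    (hι : ∀ u, antipode k (ι u) = ι (antipode k u)) (u : U) (x : K) :
    π (antipode k (ι u * x)) = π (antipode k x) * π (ι (antipode k u)) := by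
  rw [antipode_mul_antidistrib, hι, hπ.map_mul_hom]

theorem mulDefect_mul_hom (hπ : IsMulAlong ι π) (w x : K) (u : U) :
    mulDefect π w (x * ι u) = mulDefect π w x * π (ι u) := by
  simp [hπ.map_mul_hom, ← mul_assoc, sub_mul]

theorem mulDefect_hom_mul (hπ : IsMulAlong ι π) (u : U) (w x : K) :
    mulDefect π (ι u * w) x = π (ι u) * mulDefect π w x := by
  simp [hπ.map_hom_mul, mul_assoc, mul_sub]

/-- Both sides expand to π(w)π(u)π(x) - π(wux). This balancing is what lets elements of U move from
one argument of a defect to the other. -/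
theorem mulDefect_middle (hπ : IsMulAlong ι π) (w : K) (u : U) (x : K) :
    mulDefect π (w * ι u) x = mulDefect π w (ι u * x) := by
  simp [hπ.map_hom_mul, hπ.map_mul_hom, mul_assoc]

variable (hπ : IsMulAlong ι π) (hι : ∀ u, antipode k (ι u) = ι (antipode k u))
include hπ hι

theorem rightDefect_mul_hom (w x : K) (u : U) :
    rightDefect π w (x * ι u) = counit (R := k) u • rightDefect π w x :=
  sweedlerMul_mul_hom_of_counit (fun x u => hπ.mulDefect_mul_hom w x u)
    (fun x u => hπ.map_antipode_mul_hom hι x u) hπ.sweedlerMul_antipode_right x u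

theorem leftDefect_mul_hom (x : K) (u : U) (w : K) :
    leftDefect π (x * ι u) w = counit (R := k) u • leftDefect π x w := by
  refine sweedlerMul_mul_hom_of_counit (fun x u => hπ.map_mul_hom x u)
    (fun x u => ?_) hπ.sweedlerMul_antipode_right x u
  simp only [LinearMap.comp_apply, LinearMap.flip_apply, antipode_mul_antidistrib, hι]
  exact hπ.mulDefect_hom_mul _ _ _

omit hι in
theorem rightDefect_hom_mul_left (u : U) (w x : K) :
    rightDefect π (ι u * w) x = π (ι u) * rightDefect π w x := by
  simp only [rightDefect, sweedlerMul_repr (ℛ k x), hπ.mulDefect_hom_mul, mul_assoc,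
    Finset.mul_sum]

omit hι in
theorem leftDefect_mul_hom_right (x w : K) (u : U) :
    leftDefect π x (w * ι u) = leftDefect π x w * π (ι u) := by
  simp only [leftDefect, sweedlerMul_repr (ℛ k x), LinearMap.comp_apply, LinearMap.flip_apply,
    hπ.mulDefect_mul_hom, ← mul_assoc, Finset.sum_mul]

theorem rightDefect_hom_mul_right (w : K) (u : U) (x : K) :
    rightDefect π w (ι u * x) = ∑ i ∈ (ℛ k u).index,
      rightDefect π (w * ι ((ℛ k u).left i)) x * π (ι (antipode k ((ℛ k u).right i))) := by
  simp only [rightDefect]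
  rw [sweedlerMul_mul ((ℛ k u).induced ι) (ℛ k x)]
  refine Finset.sum_congr rfl fun i _ => ?_
  rw [sweedlerMul_repr (ℛ k x), Finset.sum_mul]
  refine Finset.sum_congr rfl fun j _ => ?_
  simp only [Coalgebra.Repr.induced, Function.comp, hπ.mulDefect_middle, LinearMap.comp_apply,
    hπ.map_antipode_hom_mul hι, mul_assoc]

/-- This inverts `rightDefect_hom_mul_right`, which is a convolution with π ∘ S on U: convolving
with π on the right undoes it. -/
theorem rightDefect_mul_hom_left (w : K) (u : U) (x : K) :
    rightDefect π (w * ι u) x = ∑ i ∈ (ℛ k u).index,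
      rightDefect π w (ι ((ℛ k u).left i) * x) * π (ι ((ℛ k u).right i)) := by
  let a : U →ₗ[k] B :=
    { toFun := fun u => rightDefect π (w * ι u) x
      map_add' := fun u v => by rw [map_add, mul_add, rightDefect_add_left]
      map_smul' := fun c u => by
        rw [map_smul, mul_smul_comm, rightDefect_smul_left, RingHom.id_apply] }
  have h₁ (u) : sweedlerMul a (π ∘ₗ (ι : U →ₗ[k] K) ∘ₗ antipode k) u =
      rightDefect π w (ι u * x) := by
    rw [hπ.rightDefect_hom_mul_right hι, sweedlerMul_repr (ℛ k u)]
    rfl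
  have h₂ : sweedlerMul (sweedlerMul a (π ∘ₗ (ι : U →ₗ[k] K) ∘ₗ antipode k))
      (π ∘ₗ (ι : U →ₗ[k] K)) u = a u := by
    rw [sweedlerMul_assoc, hπ.sweedlerMul_antipode_left, sweedlerMul_one]
  rw [sweedlerMul_repr (ℛ k u)] at h₂
  simp only [h₁] at h₂
  exact h₂.symm

theorem hom_mul_leftDefect (u : U) (x w : K) :
    π (ι u) * leftDefect π x w = ∑ i ∈ (ℛ k u).index,
      leftDefect π (ι ((ℛ k u).left i) * x) (ι ((ℛ k u).right i) * w) := by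
  -- The sum on the right expands to π(u₍₁₎) times the left defect at (x, S(u₍₂₎)u₍₃₎w), once
  -- S(u₍₂₎) is moved across by balancing. So u₍₁₎ ⊗ S(u₍₂₎)u₍₃₎ = u ⊗ 1 is applied to P.
  let P : U →ₗ[k] U →ₗ[k] B := LinearMap.mk₂ k
    (fun v y => π (ι v) * leftDefect π x (ι y * w))
    (fun v v' y => by rw [map_add, map_add, add_mul])
    (fun c v y => by rw [map_smul, map_smul, smul_mul_assoc])
    (fun v y y' => by rw [map_add, add_mul, leftDefect_add_right, mul_add])
    (fun c v y => by rw [map_smul, smul_mul_assoc, leftDefect_smul_right, mul_smul_comm])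
  have h := sum_left_antipode_mul_right P u
  simp only [P, LinearMap.mk₂_apply, _root_.map_one, one_mul] at h
  rw [← h]
  refine Finset.sum_congr rfl fun i _ => ?_
  simp only [leftDefect]
  rw [sweedlerMul_mul ((ℛ k ((ℛ k u).left i)).induced ι) (ℛ k x)]
  refine Finset.sum_congr rfl fun j _ => ?_
  rw [sweedlerMul_repr (ℛ k x), Finset.mul_sum]
  refine Finset.sum_congr rfl fun l _ => ?_
  simp only [Coalgebra.Repr.induced, Function.comp, LinearMap.comp_apply, LinearMap.flip_apply,
    antipode_mul_antidistrib, hι, map_mul, mul_assoc, hπ.mulDefect_middle, hπ.map_hom_mul]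

/-- If `K` is spanned by products of elements of `T` with elements of `U`, then a linear map which
is multiplicative along `U` is a partial representation as soon as the axioms hold on `T`
modulo a right ideal which is faithful for `U`. -/
theorem isPartialRep (T : Set K)
    (hT : Submodule.span k {x | ∃ t ∈ T, ∃ u : U, t * ι u = x} = ⊤)
    (N : Submodule k B) (hN : ∀ b ∈ N, ∀ c, b * c ∈ N)
    (hN₀ : ∀ b, (∀ u : U, π (ι u) * b ∈ N) → b = 0)
    (hr : ∀ s ∈ T, ∀ t ∈ T, rightDefect π s t ∈ N)
    (hl : ∀ s ∈ T, ∀ t ∈ T, leftDefect π s t ∈ N) : IsPartialRep π := by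
  have hr₁ (s) (hs : s ∈ T) (x : K) : rightDefect π s x ∈ N := by
    have hx : x ∈ Submodule.span k {x | ∃ t ∈ T, ∃ u : U, t * ι u = x} := hT ▸ Submodule.mem_top
    induction hx using Submodule.span_induction with
    | mem x hx =>
      obtain ⟨t, ht, u, rfl⟩ := hx
      rw [hπ.rightDefect_mul_hom hι]
      exact N.smul_mem _ (hr s hs t ht)
    | zero => simp [rightDefect]
    | add x y _ _ hx hy => simpa [rightDefect] using N.add_mem hx hy
    | smul c x _ hx => simpa [rightDefect] using N.smul_mem c hx
  have hr₂ (w x : K) : rightDefect π w x ∈ N := by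
    have hw : w ∈ Submodule.span k {x | ∃ t ∈ T, ∃ u : U, t * ι u = x} := hT ▸ Submodule.mem_top
    induction hw using Submodule.span_induction with
    | mem w hw =>
      obtain ⟨t, ht, u, rfl⟩ := hw
      rw [hπ.rightDefect_mul_hom_left hι]
      exact N.sum_mem fun i _ => hN _ (hr₁ t ht _) _
    | zero => simp [rightDefect, sweedlerMul]
    | add x y _ _ hx hy => rw [rightDefect_add_left]; exact N.add_mem hx hy
    | smul c x _ hx => rw [rightDefect_smul_left]; exact N.smul_mem c hx
  have hl₁ (s) (hs : s ∈ T) (w : K) : leftDefect π s w ∈ N := by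
    have hw : w ∈ Submodule.span k {x | ∃ t ∈ T, ∃ u : U, t * ι u = x} := hT ▸ Submodule.mem_top
    induction hw using Submodule.span_induction with
    | mem w hw =>
      obtain ⟨t, ht, u, rfl⟩ := hw
      rw [hπ.leftDefect_mul_hom_right]
      exact hN _ (hl s hs t ht) _
    | zero => simp [leftDefect, sweedlerMul]
    | add x y _ _ hx hy => rw [leftDefect_add_right]; exact N.add_mem hx hy
    | smul c x _ hx => rw [leftDefect_smul_right]; exact N.smul_mem c hx
  have hl₂ (x w : K) : leftDefect π x w ∈ N := by
    have hx : x ∈ Submodule.span k {x | ∃ t ∈ T, ∃ u : U, t * ι u = x} := hT ▸ Submodule.mem_top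
    induction hx using Submodule.span_induction with
    | mem x hx =>
      obtain ⟨t, ht, u, rfl⟩ := hx
      rw [hπ.leftDefect_mul_hom hι]
      exact N.smul_mem _ (hl₁ t ht w)
    | zero => simp [leftDefect]
    | add x y _ _ hx hy => simpa [leftDefect] using N.add_mem hx hy
    | smul c x _ hx => simpa [leftDefect] using N.smul_mem c hx
  -- Every defect now lies in N. Multiplying one on the left by π(ι u) gives a sum of defects, hence
  -- again an element of N, and faithfulness forces the defect to vanish.
  refine (isPartialRep_iff π).2 ⟨hπ.map_one, fun w x => hN₀ _ fun u => ?_, fun x w =>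
    hN₀ _ fun u => ?_⟩
  · rw [← hπ.rightDefect_hom_mul_left]
    exact hr₂ _ _
  · rw [hπ.hom_mul_leftDefect hι]
    exact N.sum_mem fun i _ => hl₂ _ _

end IsMulAlong

/-- Multiplicativity on U makes π(u₍₁₎)π(S(u₍₂₎)) scalar, so that the axioms, taken with this
product, become cancellation rules for arbitrary elements of K. -/
theorem IsPartialRep.isMulAlong (hπ : IsPartialRep π)
    (hι : ∀ u, antipode k (ι u) = ι (antipode k u))
    (h : ∀ u v, π (ι u * ι v) = π (ι u) * π (ι v)) : IsMulAlong ι π := by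
  obtain ⟨h₁, hr, hl⟩ := (isPartialRep_iff π).1 hπ
  have hφψ : sweedlerMul (π ∘ₗ (ι : U →ₗ[k] K)) (π ∘ₗ (ι : U →ₗ[k] K) ∘ₗ antipode k) =
      Algebra.linearMap k B ∘ₗ counit := by
    refine LinearMap.ext fun u => ?_
    rw [sweedlerMul_repr (ℛ k u)]
    have := congrArg (fun v => π (ι v)) (HopfAlgebra.sum_mul_antipode_eq_smul (ℛ k u))
    simpa [h, h₁, Algebra.algebraMap_eq_smul_one] using this
  have hψφ : sweedlerMul (π ∘ₗ (ι : U →ₗ[k] K) ∘ₗ antipode k) (π ∘ₗ (ι : U →ₗ[k] K)) =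
      Algebra.linearMap k B ∘ₗ counit := by
    refine LinearMap.ext fun u => ?_
    rw [sweedlerMul_repr (ℛ k u)]
    have := congrArg (fun v => π (ι v)) (HopfAlgebra.sum_antipode_mul_eq_smul (ℛ k u))
    simpa [h, h₁, Algebra.algebraMap_eq_smul_one] using this
  refine ⟨h₁, fun u x => ?_, fun x u => ?_⟩
  · let P : U →ₗ[k] U →ₗ[k] B := LinearMap.mk₂ k
      (fun v y => π (ι v) * π (ι y * x))
      (fun v v' y => by simp only [map_add, add_mul])
      (fun c v y => by simp only [map_smul, smul_mul_assoc])
      (fun v y y' => by simp only [map_add, add_mul, mul_add])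
      (fun c v y => by simp only [map_smul, smul_mul_assoc, mul_smul_comm])
    have hP := sum_left_antipode_mul_right P u
    simp only [P, LinearMap.mk₂_apply, _root_.map_one, one_mul] at hP
    rw [← hP]
    -- The second axiom at v, its left side collapsed. With z = u₍₃₎x it turns π(u)π(x) =
    -- π(u₍₁₎)π(S(u₍₂₎)u₍₃₎x) into π(ux).
    have h₃ (v : U) (z : K) : ∑ j ∈ (ℛ k v).index,
        π (ι ((ℛ k v).left j)) * π (ι (antipode k ((ℛ k v).right j)) * z) =
        counit (R := k) v • π z := by
      have := hl (ι v) z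
      rw [leftDefect_eq, sub_eq_zero, ← sweedlerMul_comp_hom, ← sweedlerMul_comp_hom] at this
      have hc : (π ∘ₗ antipode k) ∘ₗ (ι : U →ₗ[k] K) = π ∘ₗ (ι : U →ₗ[k] K) ∘ₗ antipode k :=
        LinearMap.ext fun v => by simp [hι]
      rw [hc, hφψ, sweedlerMul_repr (ℛ k v)] at this
      simpa [hι, Algebra.algebraMap_eq_smul_one] using this.symm
    simp only [map_mul, mul_assoc, h₃]
    have h₄ := congrArg (fun v => π (ι v * x)) (Coalgebra.sum_counit_smul (ℛ k u))
    simpa only [map_sum, map_smul, Finset.sum_mul, smul_mul_assoc] using h₄.symm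
  -- The first axiom reads a * (π∘S) = π(x)ε for a(u) = π(xu); convolving with π on the right yields
  -- a(u) = π(x)π(u).
  · let a : U →ₗ[k] B := π ∘ₗ LinearMap.mulLeft k x ∘ₗ (ι : U →ₗ[k] K)
    have ha : sweedlerMul a (π ∘ₗ (ι : U →ₗ[k] K) ∘ₗ antipode k) =
        LinearMap.mulLeft k (π x) ∘ₗ Algebra.linearMap k B ∘ₗ counit := by
      refine LinearMap.ext fun v => ?_
      have := hr x (ι v)
      rw [rightDefect_eq, sub_eq_zero, ← sweedlerMul_comp_hom, ← sweedlerMul_comp_hom] at this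
      have hc : (π ∘ₗ antipode k) ∘ₗ (ι : U →ₗ[k] K) = π ∘ₗ (ι : U →ₗ[k] K) ∘ₗ antipode k :=
        LinearMap.ext fun v => by simp [hι]
      rw [hc, hφψ] at this
      exact this.symm
    have h₂ := sweedlerMul_assoc a (π ∘ₗ (ι : U →ₗ[k] K) ∘ₗ antipode k) (π ∘ₗ (ι : U →ₗ[k] K))
    rw [hψφ, sweedlerMul_one] at h₂
    refine (LinearMap.congr_fun h₂ u).symm.trans ?_
    have h₃ := LinearMap.congr_fun (one_sweedlerMul (π ∘ₗ (ι : U →ₗ[k] K))) u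
    rw [sweedlerMul_repr (ℛ k u)] at h₃ ⊢
    rw [ha]
    simp only [LinearMap.comp_apply, LinearMap.mulLeft_apply, mul_assoc, ← Finset.mul_sum] at h₃ ⊢
    rw [h₃]
    rfl

end Multiplicative

namespace SmashProduct

/-! ### The factors U and H as Hopf subalgebras of the smash product. -/

section Inclusions

variable {k : Type uk} [Field k] {U : Type uU} [Ring U] [HopfAlgebra k U]
  {H : Type uH} [Ring H] [HopfAlgebra k H] (R : H ⊗[k] U →ₗ[k] U ⊗[k] H) [IsRSmashProduct R]

/-- The inclusion of `U` in `U #_R H` as a morphism of bialgebras. -/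
def inclUHom : U →ₐc[k] SmashProduct R :=
  BialgHom.ofAlgHom (AlgHom.ofLinearMap (inclU R) rfl (inclU_mul R))
    (AlgHom.ext fun u => by
      change counit (R := k) (u ⊗ₜ[k] (1 : H)) = counit u
      simp)
    (AlgHom.ext fun u => by
      change TensorProduct.map (inclU R) (inclU R) (comul u) = comul (R := k) (u ⊗ₜ[k] (1 : H))
      rw [TensorProduct.comul_tmul, Bialgebra.comul_one, Algebra.TensorProduct.one_def]
      induction comul (R := k) u with
      | zero => simp; rfl
      | add x y hx hy => simp only [map_add, TensorProduct.add_tmul, hx, hy]; rfl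
      | tmul x y => rfl)

/-- The inclusion of `H` in `U #_R H` as a morphism of bialgebras. -/
def inclHHom : H →ₐc[k] SmashProduct R :=
  BialgHom.ofAlgHom (AlgHom.ofLinearMap (inclH R) rfl (inclH_mul R))
    (AlgHom.ext fun h => by
      change counit (R := k) ((1 : U) ⊗ₜ[k] h) = counit h
      simp)
    (AlgHom.ext fun h => by
      change TensorProduct.map (inclH R) (inclH R) (comul h) = comul (R := k) ((1 : U) ⊗ₜ[k] h)
      rw [TensorProduct.comul_tmul, Bialgebra.comul_one, Algebra.TensorProduct.one_def]
      induction comul (R := k) h with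
      | zero => simp; rfl
      | add x y hx hy => simp only [map_add, TensorProduct.tmul_add, hx, hy]; rfl
      | tmul x y => rfl)

@[simp] theorem inclUHom_apply (u : U) : inclUHom R u = inclU R u := rfl

@[simp] theorem inclHHom_apply (h : H) : inclHHom R h = inclH R h := rfl

theorem antipode_inclUHom (u : U) : antipode k (inclUHom R u) = inclUHom R (antipode k u) := by
  refine (antipodeMap_mk R u 1).trans ?_
  rw [antipode_one, show inclH R 1 = 1 from rfl, one_mul]
  rfl

theorem antipode_inclHHom (h : H) : antipode k (inclHHom R h) = inclHHom R (antipode k h) := by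
  refine (antipodeMap_mk R 1 h).trans ?_
  rw [antipode_one, show inclU R 1 = 1 from rfl, mul_one]
  rfl

end Inclusions

/-! ### The partial representation on B ⊗ U induced from one of H on B. -/

section RightAction

variable {k : Type uk} [Field k] {U : Type uU} [Ring U] [HopfAlgebra k U]
  {H : Type uH} [Ring H] [HopfAlgebra k H] {B : Type uB} [Ring B] [Algebra k B]
  (R : H ⊗[k] U ≃ₗ[k] U ⊗[k] H)

section

variable [IsSmashProduct R.toLinearMap]

/-- Surjectivity of R says that the products hu, in this order, span. -/
theorem induction_inclH_mul_inclU {p : SmashProduct R.toLinearMap → Prop}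
    (x : SmashProduct R.toLinearMap) (zero : p 0) (add : ∀ x y, p x → p y → p (x + y))
    (mul : ∀ h u, p (inclH R.toLinearMap h * inclU R.toLinearMap u)) : p x := by
  obtain ⟨y, rfl⟩ := R.surjective x
  induction y with
  | zero => rw [map_zero]; exact zero
  | add y z hy hz => rw [map_add]; exact add _ _ hy hz
  | tmul h u =>
    have := mul h u
    rwa [inclH_mul_inclU] at this

variable (ρ : H →ₗ[k] B)

/-- The linear map `hu ↦ mρ(h) ⊗ u` on `U #_R H`, for `m ∈ B`. -/
def factor (m : B) : SmashProduct R.toLinearMap →ₗ[k] B ⊗[k] U :=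
  TensorProduct.map (LinearMap.mul k _ m ∘ₗ ρ) LinearMap.id ∘ₗ R.symm.toLinearMap

theorem factor_apply (m : B) (h : H) (u : U) :
    factor R ρ m (inclH R.toLinearMap h * inclU R.toLinearMap u) = (m * ρ h) ⊗ₜ u := by
  rw [inclH_mul_inclU]
  change TensorProduct.map _ _ (R.symm (R (h ⊗ₜ u))) = _
  simp

theorem factor_add (m m' : B) (x : SmashProduct R.toLinearMap) :
    factor R ρ (m + m') x = factor R ρ m x + factor R ρ m' x := by
  change TensorProduct.map _ _ (R.symm x) =
    TensorProduct.map _ _ (R.symm x) + TensorProduct.map _ _ (R.symm x)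
  simp [LinearMap.add_comp, TensorProduct.map_add_left]

theorem factor_smul (c : k) (m : B) (x : SmashProduct R.toLinearMap) :
    factor R ρ (c • m) x = c • factor R ρ m x := by
  change TensorProduct.map _ _ (R.symm x) = c • TensorProduct.map _ _ (R.symm x)
  simp [LinearMap.smul_comp, TensorProduct.map_smul_left]

/-- The right action of `U #_R H` on `B ⊗ U`: for `vw = ∑ h'v'`, it sends `m ⊗ v` to
`∑ mρ(h') ⊗ v'`. -/
def rightAct : SmashProduct R.toLinearMap →ₗ[k] (Module.End k (B ⊗[k] U))ᵐᵒᵖ where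
  toFun w := MulOpposite.op <| TensorProduct.lift <| LinearMap.mk₂ k
    (fun m v => factor R ρ m (inclU R.toLinearMap v * w))
    (fun m m' v => factor_add R ρ m m' _)
    (fun c m v => factor_smul R ρ c m _)
    (fun m v v' => by rw [map_add, add_mul, map_add])
    (fun c m v => by rw [map_smul, smul_mul_assoc, map_smul])
  map_add' w w' := MulOpposite.unop_injective <| TensorProduct.ext' fun m v => by
    simp [mul_add]
  map_smul' c w := MulOpposite.unop_injective <| TensorProduct.ext' fun m v => by
    simp

@[simp]
theorem unop_rightAct_tmul (w : SmashProduct R.toLinearMap) (m : B) (v : U) :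
    (rightAct R ρ w).unop (m ⊗ₜ v) = factor R ρ m (inclU R.toLinearMap v * w) := rfl

theorem factor_inclU (hρ : ρ 1 = 1) (m : B) (v : U) :
    factor R ρ m (inclU R.toLinearMap v) = m ⊗ₜ v := by
  have := factor_apply R ρ m 1 v
  rwa [show inclH R.toLinearMap 1 = 1 from rfl, one_mul, hρ, mul_one] at this

theorem factor_inclH (m : B) (h : H) :
    factor R ρ m (inclH R.toLinearMap h) = (m * ρ h) ⊗ₜ 1 := by
  have := factor_apply R ρ m h 1
  rwa [show inclU R.toLinearMap 1 = 1 from rfl, mul_one] at this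

theorem unop_rightAct_inclU (hρ : ρ 1 = 1) (m : B) (u v : U) :
    (rightAct R ρ (inclU R.toLinearMap u)).unop (m ⊗ₜ v) = m ⊗ₜ (v * u) := by
  rw [unop_rightAct_tmul, ← inclU_mul, factor_inclU _ _ hρ]

/-- Only vectors m ⊗ 1 see H acting directly through ρ; on m ⊗ v the product vh must first be
reordered by R⁻¹. -/
theorem unop_rightAct_inclH (m : B) (h : H) :
    (rightAct R ρ (inclH R.toLinearMap h)).unop (m ⊗ₜ 1) = (m * ρ h) ⊗ₜ 1 := by
  rw [unop_rightAct_tmul, show inclU R.toLinearMap 1 = 1 from rfl, one_mul, factor_inclH]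

theorem factor_mul_inclU (hρ : ρ 1 = 1) (m : B) (x : SmashProduct R.toLinearMap) (u : U) :
    factor R ρ m (x * inclU R.toLinearMap u) =
      (rightAct R ρ (inclU R.toLinearMap u)).unop (factor R ρ m x) := by
  induction x using induction_inclH_mul_inclU with
  | zero => simp
  | add x y hx hy => simp only [add_mul, map_add, hx, hy]
  | mul h v =>
    rw [mul_assoc, ← inclU_mul, factor_apply, factor_apply, unop_rightAct_inclU _ _ hρ]

end

variable [IsRSmashProduct R.toLinearMap] (ρ : H →ₗ[k] B)

theorem isMulAlong_rightAct (hρ : ρ 1 = 1) :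
    IsMulAlong (B := (Module.End k (B ⊗[k] U))ᵐᵒᵖ) (inclUHom R.toLinearMap) (rightAct R ρ) where
  map_one := MulOpposite.unop_injective <| TensorProduct.ext' fun m v => by
    simp [factor_inclU _ _ hρ]
  map_hom_mul u x := MulOpposite.unop_injective <| TensorProduct.ext' fun m v => by
    simp only [inclUHom_apply, MulOpposite.unop_mul, Module.End.mul_apply,
      unop_rightAct_inclU _ _ hρ]
    simp only [unop_rightAct_tmul, inclU_mul, mul_assoc]
  map_mul_hom x u := MulOpposite.unop_injective <| TensorProduct.ext' fun m v => by
    simp only [inclUHom_apply, MulOpposite.unop_mul, Module.End.mul_apply,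
      unop_rightAct_tmul, ← factor_mul_inclU _ _ hρ, mul_assoc]

theorem span_inclH_mul_inclU :
    Submodule.span k {x | ∃ t ∈ Set.range (inclHHom R.toLinearMap), ∃ u : U,
      t * inclUHom R.toLinearMap u = x} = ⊤ := by
  refine Submodule.eq_top_iff'.2 fun x => ?_
  induction x using induction_inclH_mul_inclU with
  | zero => exact zero_mem _
  | add x y hx hy => exact add_mem hx hy
  | mul h v => exact Submodule.subset_span ⟨_, ⟨h, rfl⟩, v, rfl⟩

theorem unop_mulDefect_rightAct (m : B) (g h : H) :
    (mulDefect (B := (Module.End k (B ⊗[k] U))ᵐᵒᵖ) (rightAct R ρ)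
      (inclH R.toLinearMap g) (inclH R.toLinearMap h)).unop (m ⊗ₜ 1) =
      (m * mulDefect ρ g h) ⊗ₜ 1 := by
  simp only [mulDefect_apply, MulOpposite.unop_sub, MulOpposite.unop_mul, LinearMap.sub_apply,
    Module.End.mul_apply, ← inclH_mul, unop_rightAct_inclH, mul_sub, TensorProduct.sub_tmul,
    mul_assoc]

theorem unop_rightDefect_rightAct (m : B) (g h : H) :
    (rightDefect (B := (Module.End k (B ⊗[k] U))ᵐᵒᵖ) (rightAct R ρ)
      (inclHHom R.toLinearMap g) (inclHHom R.toLinearMap h)).unop (m ⊗ₜ 1) =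
      (m * rightDefect ρ g h) ⊗ₜ 1 := by
  rw [rightDefect, rightDefect, sweedlerMul_repr ((ℛ k h).induced (inclHHom R.toLinearMap)),
    sweedlerMul_repr (ℛ k h), Finset.mul_sum, TensorProduct.sum_tmul, Finset.unop_sum,
    LinearMap.sum_apply]
  refine Finset.sum_congr rfl fun i _ => ?_
  simp only [Coalgebra.Repr.induced, Function.comp, LinearMap.comp_apply, MulOpposite.unop_mul,
    Module.End.mul_apply, antipode_inclHHom]
  simp only [inclHHom_apply, unop_mulDefect_rightAct, unop_rightAct_inclH, mul_assoc]

theorem unop_leftDefect_rightAct (m : B) (g h : H) :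
    (leftDefect (B := (Module.End k (B ⊗[k] U))ᵐᵒᵖ) (rightAct R ρ)
      (inclHHom R.toLinearMap g) (inclHHom R.toLinearMap h)).unop (m ⊗ₜ 1) =
      (m * leftDefect ρ g h) ⊗ₜ 1 := by
  rw [leftDefect, leftDefect, sweedlerMul_repr ((ℛ k g).induced (inclHHom R.toLinearMap)),
    sweedlerMul_repr (ℛ k g), Finset.mul_sum, TensorProduct.sum_tmul, Finset.unop_sum,
    LinearMap.sum_apply]
  refine Finset.sum_congr rfl fun i _ => ?_
  simp only [Coalgebra.Repr.induced, Function.comp, LinearMap.comp_apply, MulOpposite.unop_mul,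
    Module.End.mul_apply, antipode_inclHHom, LinearMap.flip_apply]
  simp only [inclHHom_apply, unop_mulDefect_rightAct, unop_rightAct_inclH, mul_assoc]

variable {ρ}

theorem isPartialRep_rightAct (hρ : IsPartialRep ρ) :
    IsPartialRep (B := (Module.End k (B ⊗[k] U))ᵐᵒᵖ) (rightAct R ρ) := by
  -- N is the annihilator of B ⊗ 1. In the opposite algebra the left factor of a product acts first,
  -- so N is a right ideal.
  let N : Submodule k (Module.End k (B ⊗[k] U))ᵐᵒᵖ :=
    { carrier := {b | ∀ m : B, b.unop (m ⊗ₜ 1) = 0}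
      zero_mem' := fun m => by simp
      add_mem' := fun {b c} hb hc m => by simp [hb m, hc m]
      smul_mem' := fun c b hb m => by simp [hb m] }
  obtain ⟨h₁, hr, hl⟩ := (isPartialRep_iff ρ).1 hρ
  refine (isMulAlong_rightAct R ρ h₁).isPartialRep (antipode_inclUHom R.toLinearMap)
    (Set.range (inclHHom R.toLinearMap)) (span_inclH_mul_inclU R) N ?_ ?_ ?_ ?_
  · intro b hb c m
    simp [hb m]
  -- Faithfulness: m ⊗ v is the image of m ⊗ 1 under v, so U moves B ⊗ 1 over all of B ⊗ U.
  · intro b hb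
    refine MulOpposite.unop_injective <| TensorProduct.ext' fun m v => ?_
    have := hb v m
    rw [MulOpposite.unop_mul, Module.End.mul_apply, inclUHom_apply,
      unop_rightAct_inclU _ _ h₁, one_mul] at this
    simpa using this
  · rintro _ ⟨g, rfl⟩ _ ⟨h, rfl⟩ m
    rw [unop_rightDefect_rightAct, hr, mul_zero, TensorProduct.zero_tmul]
  · rintro _ ⟨g, rfl⟩ _ ⟨h, rfl⟩ m
    rw [unop_leftDefect_rightAct, hl, mul_zero, TensorProduct.zero_tmul]

end RightAction

end SmashProduct

section

variable {k : Type uk} [Field k] {K : Type uH} [Ring K] [HopfAlgebra k K]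

theorem Hpar.induction {p : Hpar k K → Prop} (algebraMap : ∀ c, p (algebraMap k _ c))
    (bracket : ∀ x, p (bracket k K x)) (mul : ∀ x y, p x → p y → p (x * y))
    (add : ∀ x y, p x → p y → p (x + y)) (x : Hpar k K) : p x := by
  obtain ⟨t, rfl⟩ := RingQuot.mkAlgHom_surjective k (HparRel k K) x
  induction t using TensorAlgebra.induction with
  | algebraMap c => rw [AlgHom.commutes]; exact algebraMap c
  | ι x => exact bracket x
  | mul x y hx hy => rw [map_mul]; exact mul _ _ hx hy
  | add x y hx hy => rw [map_add]; exact add _ _ hx hy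

theorem lift_bracket_eq (h : IsPartialRep (bracket k K)) (x : Hpar k K) : h.lift x = x := by
  induction x using Hpar.induction with
  | algebraMap c => exact AlgHom.commutes _ c
  | bracket x => exact h.lift_bracket x
  | mul x y hx hy => rw [map_mul, hx, hy]
  | add x y hx hy => rw [map_add, hx, hy]

end

namespace SmashProduct

variable {k : Type uk} [Field k] {U : Type uU} [Ring U] [HopfAlgebra k U]
  {H : Type uH} [Ring H] [HopfAlgebra k H]

/-! ### The comparison map from H_par to (U #_R H)_par. -/

section HparMap

variable (R : H ⊗[k] U →ₗ[k] U ⊗[k] H) [IsRSmashProduct R]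

/-- The algebra map `H_par → (U #_R H)_par`, `[h] ↦ [1 #_R h]`. -/
def hparMap : Hpar k H →ₐ[k] Hpar k (SmashProduct R) :=
  (isPartialRep_bracket.comp_hom (antipode_inclHHom R)).lift

theorem hparMap_bracket (h : H) :
    hparMap R (bracket k H h) = bracket k (SmashProduct R) (inclHHom R h) :=
  IsPartialRep.lift_bracket _ h

theorem hparMap_epsHpar (h : H) :
    hparMap R (epsHpar k H h) = epsHpar k (SmashProduct R) (inclHHom R h) := by
  rw [epsHpar, epsHpar, comp_sweedlerMul, ← sweedlerMul_comp_hom]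
  congr 2
  · exact LinearMap.ext fun x => hparMap_bracket R x
  · refine LinearMap.ext fun x => (hparMap_bracket R _).trans ?_
    rw [← antipode_inclHHom]
    rfl

theorem hparMap_epsTildeHpar (h : H) :
    hparMap R (epsTildeHpar k H h) = epsTildeHpar k (SmashProduct R) (inclHHom R h) := by
  rw [epsTildeHpar, epsTildeHpar, comp_sweedlerMul, ← sweedlerMul_comp_hom]
  congr 2
  · refine LinearMap.ext fun x => (hparMap_bracket R _).trans ?_
    rw [← antipode_inclHHom]
    rfl
  · exact LinearMap.ext fun x => hparMap_bracket R x

end HparMap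

/-! ### Collapsing ε and ε̃ along U when U = U_par. -/

section Global

variable (R : H ⊗[k] U →ₗ[k] U ⊗[k] H) [IsRSmashProduct R]

theorem isMulAlong_bracket (hU : EveryPartialRepGlobal k U) :
    IsMulAlong (inclUHom R) (bracket k (SmashProduct R)) := by
  refine isPartialRep_bracket.isMulAlong (antipode_inclUHom R) fun u v => ?_
  have := (isPartialRep_bracket.comp_hom (antipode_inclUHom R)).map_mul_of_everyPartialRepGlobal
    hU u v
  rw [← map_mul]
  exact this

theorem epsHpar_mul_inclU (hU : EveryPartialRepGlobal k U) (x : SmashProduct R) (u : U) :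
    epsHpar k (SmashProduct R) (x * inclU R u) =
      counit (R := k) u • epsHpar k (SmashProduct R) x :=
  have hπ := isMulAlong_bracket R hU
  sweedlerMul_mul_hom_of_counit (ι := inclUHom R) (fun x u => hπ.map_mul_hom x u)
    (fun x u => hπ.map_antipode_mul_hom (antipode_inclUHom R) x u)
    hπ.sweedlerMul_antipode_right x u

theorem epsTildeHpar_inclU_mul (hU : EveryPartialRepGlobal k U) (u : U) (x : SmashProduct R) :
    epsTildeHpar k (SmashProduct R) (inclU R u * x) =
      counit (R := k) u • epsTildeHpar k (SmashProduct R) x :=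
  have hπ := isMulAlong_bracket R hU
  sweedlerMul_hom_mul_of_counit (ι := inclUHom R)
    (fun u x => hπ.map_antipode_hom_mul (antipode_inclUHom R) u x)
    (fun u x => hπ.map_hom_mul u x) hπ.sweedlerMul_antipode_left u x

theorem epsTildeHpar_mk (hU : EveryPartialRepGlobal k U) (u : U) (h : H) :
    epsTildeHpar k (SmashProduct R) (mk R u h) =
      hparMap R (counit (R := k) u • epsTildeHpar k H h) := by
  rw [← inclU_mul_inclH, epsTildeHpar_inclU_mul R hU, map_smul, hparMap_epsTildeHpar]
  rfl

end Global

variable (R : H ⊗[k] U ≃ₗ[k] U ⊗[k] H) [IsRSmashProduct R.toLinearMap]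

theorem epsHpar_mk (hU : EveryPartialRepGlobal k U) (u : U) (h : H) :
    epsHpar k (SmashProduct R.toLinearMap) (mk R.toLinearMap u h) =
      hparMap R.toLinearMap (epsHpar k H (blackAct R u h)) := by
  rw [hparMap_epsHpar]
  -- R(g ⊗ v) is the product gv, on which ε splits off the counit of v; the case z = R⁻¹(u ⊗ h) is
  -- the one needed.
  have key (z : H ⊗[k] U) : epsHpar k (SmashProduct R.toLinearMap) (R z) =
      epsHpar k (SmashProduct R.toLinearMap) (inclHHom R.toLinearMap
        (TensorProduct.rid k H ((counit (R := k) (A := U)).lTensor H z))) := by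
    induction z with
    | zero => simp only [map_zero]; exact map_zero _
    | add y z hy hz => simp only [map_add, ← hy, ← hz]; exact map_add _ _ _
    | tmul g v =>
      have := epsHpar_mul_inclU R.toLinearMap hU (inclH R.toLinearMap g) v
      rw [inclH_mul_inclU] at this
      refine this.trans ?_
      simp
  have := key (R.symm (u ⊗ₜ h))
  rw [R.apply_symm_apply] at this
  exact this

theorem unop_lift_hparMap {B : Type uB} [Ring B] [Algebra k B] {ρ : H →ₗ[k] B}
    (hρ : IsPartialRep ρ) (x : Hpar k H) (m : B) :
    ((isPartialRep_rightAct R hρ).lift (hparMap R.toLinearMap x)).unop (m ⊗ₜ 1) =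
      (m * hρ.lift x) ⊗ₜ 1 := by
  induction x using Hpar.induction generalizing m with
  | algebraMap c =>
    simp [Algebra.algebraMap_eq_smul_one, TensorProduct.smul_tmul']
  | bracket h =>
    rw [hparMap_bracket, IsPartialRep.lift_bracket, IsPartialRep.lift_bracket, inclHHom_apply,
      unop_rightAct_inclH]
  | mul x y hx hy => simp only [map_mul, MulOpposite.unop_mul, Module.End.mul_apply, hx, hy,
      mul_assoc]
  | add x y hx hy => simp only [map_add, MulOpposite.unop_add, LinearMap.add_apply, hx, hy,
      mul_add, TensorProduct.add_tmul]

/-- For ρ = [·], acting on 1 ⊗ 1 turns the image of x into x ⊗ 1 in H_par ⊗ U, and the counit of U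
removes the second factor. -/
theorem hparMap_injective : Function.Injective (hparMap R.toLinearMap) := by
  have hπ := isPartialRep_bracket (k := k) (K := H)
  intro x y hxy
  have h := unop_lift_hparMap R hπ x 1
  rw [hxy, unop_lift_hparMap R hπ y 1] at h
  have := congrArg
    (fun z => TensorProduct.rid k (Hpar k H) ((counit (R := k) (A := U)).lTensor _ z)) h
  simpa [lift_bracket_eq] using this.symm

/-- A linear map on `U #_R H` has the same range as its restriction to `H` if it sends each
`u #_R h` into the range of that restriction. -/
theorem image_range_eq {M M' : Type*} [AddCommGroup M] [Module k M] [AddCommGroup M'] [Module k M']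
    (R : H ⊗[k] U →ₗ[k] U ⊗[k] H) [IsRSmashProduct R]
    (φ : M →ₗ[k] M') (F : H →ₗ[k] M) (G : SmashProduct R →ₗ[k] M')
    (hFG : ∀ h, φ (F h) = G (inclHHom R h)) (hG : ∀ u h, ∃ h', G (mk R u h) = φ (F h')) :
    φ '' Set.range F = Set.range G := by
  refine Set.Subset.antisymm ?_ ?_
  · rintro _ ⟨_, ⟨h, rfl⟩, rfl⟩
    exact ⟨_, (hFG h).symm⟩
  · rintro _ ⟨x, rfl⟩
    suffices h : ∃ h', φ (F h') = G x from let ⟨h', e⟩ := h; ⟨_, ⟨h', rfl⟩, e⟩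
    change U ⊗[k] H at x
    induction x with
    | zero => exact ⟨0, by rw [map_zero, map_zero]; exact (map_zero G).symm⟩
    | add x y hx hy =>
      obtain ⟨a, ha⟩ := hx
      obtain ⟨b, hb⟩ := hy
      exact ⟨a + b, by rw [map_add, map_add, ha, hb]; exact (map_add G _ _).symm⟩
    | tmul u h =>
      obtain ⟨h', e⟩ := hG u h
      exact ⟨h', e.symm⟩

end SmashProduct

/-- An injective algebra map identifies the subalgebra generated by a set with the subalgebra
generated by its image. -/
theorem exists_adjoin_equiv {k A A' : Type*} [Field k] [Ring A] [Ring A'] [Algebra k A]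
    [Algebra k A'] (φ : A →ₐ[k] A') (hφ : Function.Injective φ) {s : Set A} {t : Set A'}
    (hst : φ '' s = t) :
    ∃ e : Algebra.adjoin k s ≃ₐ[k] Algebra.adjoin k t, ∀ x, (e x : A') = φ x := by
  have h : (Algebra.adjoin k s).map φ = Algebra.adjoin k t := by rw [AlgHom.map_adjoin, hst]
  exact ⟨((Algebra.adjoin k s).equivMapOfInjective φ hφ).trans (Subalgebra.equivOfEq _ _ h),
    fun x => rfl⟩

end PartialHopf

end
open PartialHopf in
theorem proposition3p15 {k : Type uk} [Field k]
    {U : Type uU} [Ring U] [HopfAlgebra k U] {H : Type uH} [Ring H] [HopfAlgebra k H]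
    (hU : EveryPartialRepGlobal k U)
    (R : H ⊗[k] U ≃ₗ[k] U ⊗[k] H) [IsRSmashProduct R.toLinearMap] :
    (∃ α : Apar k (SmashProduct R.toLinearMap) ≃ₐ[k] Apar k H,
      (∀ (u : U) (h : H),
        α (eps k (SmashProduct.mk R.toLinearMap u h)) = eps k (blackAct R u h)) ∧
      (∀ h : H, α.symm (eps k h) = eps k (SmashProduct.mk R.toLinearMap 1 h))) ∧
    (∃ β : AparTilde k (SmashProduct R.toLinearMap) ≃ₐ[k] AparTilde k H,
      (∀ (u : U) (h : H),
        β (epsTilde k (SmashProduct.mk R.toLinearMap u h)) =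
          Coalgebra.counit (R := k) u • epsTilde k h) ∧
      (∀ h : H, β.symm (epsTilde k h) = epsTilde k (SmashProduct.mk R.toLinearMap 1 h))) := by
  constructor
  · have hrange : SmashProduct.hparMap R.toLinearMap '' Set.range (epsHpar k H) =
        Set.range (epsHpar k (SmashProduct R.toLinearMap)) :=
      SmashProduct.image_range_eq R.toLinearMap (SmashProduct.hparMap R.toLinearMap).toLinearMap _ _
        (SmashProduct.hparMap_epsHpar R.toLinearMap)
        fun u h => ⟨_, SmashProduct.epsHpar_mk R hU u h⟩
    obtain ⟨e, he⟩ := exists_adjoin_equiv _ (SmashProduct.hparMap_injective R) hrange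
    -- The comparison map starts from H_par, so the required isomorphism is its inverse.
    refine ⟨e.symm, fun u h => ?_, fun h => ?_⟩
    · refine (AlgEquiv.symm_apply_eq e).2 (Subtype.ext ?_)
      exact (SmashProduct.epsHpar_mk R hU u h).trans (he (eps k (blackAct R u h))).symm
    · exact Subtype.ext ((he _).trans (SmashProduct.hparMap_epsHpar R.toLinearMap h))
  · have hrange : SmashProduct.hparMap R.toLinearMap '' Set.range (epsTildeHpar k H) =
        Set.range (epsTildeHpar k (SmashProduct R.toLinearMap)) :=
      SmashProduct.image_range_eq R.toLinearMap (SmashProduct.hparMap R.toLinearMap).toLinearMap _ _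
        (SmashProduct.hparMap_epsTildeHpar R.toLinearMap) fun u h =>
          ⟨Coalgebra.counit (R := k) u • h, by
            rw [map_smul]; exact SmashProduct.epsTildeHpar_mk R.toLinearMap hU u h⟩
    obtain ⟨e, he⟩ := exists_adjoin_equiv _ (SmashProduct.hparMap_injective R) hrange
    refine ⟨e.symm, fun u h => ?_, fun h => ?_⟩
    · refine (AlgEquiv.symm_apply_eq e).2 (Subtype.ext ?_)
      exact (SmashProduct.epsTildeHpar_mk R.toLinearMap hU u h).trans
        (he (Coalgebra.counit (R := k) u • epsTilde k h)).symm
    · exact Subtype.ext ((he _).trans (SmashProduct.hparMap_epsTildeHpar R.toLinearMap h))
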